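/- Let $G$ be a finite connected directed graph (multiple edges allowed, no looped edges), regarded as a topological space, and let $f:G\to G$ be a continuous map that permutes the vertices and is homotopic to the identity. Let $E$ be an edge of $G$ with initial vertex $V_1$ and terminal vertex $V_2$. Choose a base vertex $x_0$ and a spanning tree $T$ of $G$ containing $E$. Then $\pi=\pi_1(G,x_0)$ is the free group on the edges outside $T$ (such an edge stands for the loop obtained by adding it to $T$), and "word" refers to this basis. Label the universal cover $\widetilde G$ by $T$: the vertices are $g\widetilde V$ and the edges $g\widetilde D$ with $g\in\pi$, where $\pi$ acts on the left by covering transformations, and if the edge $D$ goes from $V$ to $V'$, then $g\widetilde D$ goes from $g\widetilde V$ to $g\theta_D\widetilde V'$, with $\theta_D=1$ for $D\in T$ and $\theta_D$ the generator given by $D$ for $D\notin T$. For $x\in G$ let $\widetilde x$ be the lift of $x$ that is $\widetilde V$ if $x$ is a vertex $V$, and lies in $\widetilde D$ if $x$ is in the interior of an edge $D$. Let $\widetilde f$ be the lift of $f$ at which the lift to $\widetilde G$, starting at the identity, of some homotopy from the identity to $f$ ends. If $f^n(x)=x$ with $n\ge 1$ and $\widetilde f^n(\widetilde x)=v\widetilde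 x$ with $v\in\pi$, the rotation element of $x$ is the formal root $\rho(x)=v^{1/n}$; here $v^{1/n}=u^{1/m}$ means that $v^a=u^b$ for some positive integers $a,b$ with $na=mb$, and $u^{k/m}$ means $(u^k)^{1/m}$. The edge $E$ belongs to $w\in\pi$ if every cyclic reduction of an edge loop at $x_0$ representing $w$ (every cyclically reduced edge loop obtained from it by cancelling adjacent inverse edges and changing the base point) uses $E$ or $E^{-1}$. **Theorem.** Suppose that $E$ belongs to $w\in\pi$, and that $\rho(V_1)=w^{k_1/m}$ and $\rho(V_2)=w^{k_2/n}$ with integers $k_1,k_2$ and positive integers $m,n$. Then for every rational number $r$ between $k_1/m$ and $k_2/n$ (endpoints allowed) there are an integer $p$ and a positive integer $q$ with $p/q=r$, and a periodic point $x\in E$ of $f$ such that $\rho(x)=(w^p\gamma)^{1/q}$ for some initial subword $\gamma$ of the reduced word $w$ (possibly empty or all of $w$). -/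

import Mathlib

/-- A directed graph with vertex set `V` and edge set `E`; multiple edges are allowed, looped
edges are not. -/
structure DirectedGraph (V E : Type*) where
  /-- the initial vertex of an edge -/
  src : E → V
  /-- the terminal vertex of an edge -/
  tgt : E → V
  no_loops : ∀ e, src e ≠ tgt e

namespace DirectedGraph

section Realization

variable {V E V' E' : Type*}

/-- The disjoint union of the vertices and of one unit interval for every edge. -/
def Cells (_G : DirectedGraph V E) : Type _ := V ⊕ (Σ _ : E, unitInterval)

/-- The vertices are discrete, and the intervals have their usual topology. -/
instance (G : DirectedGraph V E) : TopologicalSpace G.Cells :=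
  @instTopologicalSpaceSum V (Σ _ : E, unitInterval) ⊥ inferInstance

/-- The endpoint `0` of the interval of `e` is glued to the initial vertex of `e`, and the
endpoint `1` to its terminal vertex. -/
inductive Glue (G : DirectedGraph V E) : G.Cells → G.Cells → Prop
  | src (e : E) : Glue G (Sum.inr ⟨e, 0⟩) (Sum.inl (G.src e))
  | tgt (e : E) : Glue G (Sum.inr ⟨e, 1⟩) (Sum.inl (G.tgt e))

/-- The topological space of the graph, with the quotient topology. -/
def Realization (G : DirectedGraph V E) : Type _ := Quot G.Glue

instance (G : DirectedGraph V E) : TopologicalSpace G.Realization :=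
  inferInstanceAs (TopologicalSpace (Quot G.Glue))

/-- A vertex as a point of the graph. -/
def vertex (G : DirectedGraph V E) (v : V) : G.Realization := Quot.mk _ (Sum.inl v)

/-- The point with coordinate `t` on the edge `e`. -/
def point (G : DirectedGraph V E) (e : E) (t : unitInterval) : G.Realization :=
  Quot.mk _ (Sum.inr ⟨e, t⟩)

/-- The closed edge `e` as a subset of the graph. -/
def edge (G : DirectedGraph V E) (e : E) : Set G.Realization := Set.range (G.point e)

theorem point_zero (G : DirectedGraph V E) (e : E) : G.point e 0 = G.vertex (G.src e) :=
  Quot.sound (Glue.src e)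

theorem point_one (G : DirectedGraph V E) (e : E) : G.point e 1 = G.vertex (G.tgt e) :=
  Quot.sound (Glue.tgt e)

/-- The map of spaces induced by a map of graphs; it preserves the coordinates on edges. -/
def mapRealization (G : DirectedGraph V E) (G' : DirectedGraph V' E') (φ : V → V') (ψ : E → E')
    (hs : ∀ e, G'.src (ψ e) = φ (G.src e)) (ht : ∀ e, G'.tgt (ψ e) = φ (G.tgt e)) :
    G.Realization → G'.Realization :=
  Quot.lift
    (fun c => match c with
      | Sum.inl v => G'.vertex (φ v)
      | Sum.inr ⟨e, t⟩ => G'.point (ψ e) t)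
    (by
      rintro _ _ (e | e)
      · exact (G'.point_zero (ψ e)).trans (congrArg G'.vertex (hs e))
      · exact (G'.point_one (ψ e)).trans (congrArg G'.vertex (ht e)))

end Realization

section EdgePaths

variable {V E : Type*}

/-- The first vertex of the oriented edge `(e, b)`, where `(e, true)` stands for `e` and
`(e, false)` for its reverse. -/
def start (G : DirectedGraph V E) (d : E × Bool) : V := if d.2 then G.src d.1 else G.tgt d.1

/-- The last vertex of an oriented edge. -/
def finish (G : DirectedGraph V E) (d : E × Bool) : V := if d.2 then G.tgt d.1 else G.src d.1

/-- `G.IsEdgePath u P v`: the list `P` of oriented edges is an edge path from `u` to `v`. -/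
def IsEdgePath (G : DirectedGraph V E) : V → List (E × Bool) → V → Prop
  | u, [], v => u = v
  | u, d :: P, v => G.start d = u ∧ G.IsEdgePath (G.finish d) P v

/-- `T` is (the edge set of) a spanning tree: any two vertices are joined by exactly one edge
path in `T` without backtracking. -/
def IsSpanningTree (G : DirectedGraph V E) (T : Set E) : Prop :=
  ∀ u v : V, ∃! P : List (E × Bool),
    G.IsEdgePath u P v ∧ FreeGroup.IsReduced P ∧ ∀ d ∈ P, d.1 ∈ T

/-- `Q` is a cyclic reduction of the edge loop `P`: it is cyclically reduced, and it is obtained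
from `P` by cancelling adjacent inverse edges and changing the base point. -/
def IsCyclicReduction (P Q : List (E × Bool)) : Prop :=
  FreeGroup.IsCyclicallyReduced Q ∧
    Relation.ReflTransGen (fun A B => FreeGroup.Red.Step A B ∨ A.IsRotated B) P Q

end EdgePaths

section UniversalCover

variable {V E : Type*}

/-- The fundamental group, as the free group on the edges outside of the spanning tree `T`: such
an edge stands for the loop obtained by adding it to `T`. -/
abbrev Pi1 (_G : DirectedGraph V E) (T : Set E) : Type _ := FreeGroup {e : E // e ∉ T}

open Classical in
/-- The element `θ_e` of the fundamental group: trivial if `e` is in the spanning tree, and the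
generator given by `e` otherwise. -/
noncomputable def theta (G : DirectedGraph V E) (T : Set E) (e : E) : G.Pi1 T :=
  if h : e ∈ T then 1 else FreeGroup.of ⟨e, h⟩

/-- The element of the fundamental group represented by an edge loop. -/
noncomputable def loopClass (G : DirectedGraph V E) (T : Set E) (P : List (E × Bool)) : G.Pi1 T :=
  FreeGroup.lift (G.theta T) (FreeGroup.mk P)

/-- The edge `e` belongs to `α`: every cyclic reduction of an edge loop at the base point `x₀`
that represents `α` uses `e` or its reverse. -/
def Belongs (G : DirectedGraph V E) (x₀ : V) (T : Set E) (e : E) (α : G.Pi1 T) : Prop :=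
  ∀ P, G.IsEdgePath x₀ P x₀ → G.loopClass T P = α →
    ∀ Q, IsCyclicReduction P Q → ∃ b : Bool, (e, b) ∈ Q

/-- The universal cover as a graph, with its coherent labelling by the spanning tree `T`: the
vertices are `g Ṽ`, the edges are `g Ẽ`, and `g Ẽ` goes from `g Ṽ₁` to `g θ_E Ṽ₂` if `E` goes
from `V₁` to `V₂`. -/
noncomputable def coverGraph (G : DirectedGraph V E) (T : Set E) :
    DirectedGraph (G.Pi1 T × V) (G.Pi1 T × E) where
  src d := (d.1, G.src d.2)
  tgt d := (d.1 * G.theta T d.2, G.tgt d.2)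
  no_loops d h := G.no_loops d.2 (congrArg Prod.snd h)

/-- The universal covering space. -/
abbrev UniversalCover (G : DirectedGraph V E) (T : Set E) : Type _ := (G.coverGraph T).Realization

/-- The covering projection. -/
noncomputable def proj (G : DirectedGraph V E) (T : Set E) : G.UniversalCover T → G.Realization :=
  mapRealization (G.coverGraph T) G Prod.snd Prod.snd (fun _ => rfl) (fun _ => rfl)

/-- The covering transformation given by an element `g` of the fundamental group. -/
noncomputable def deck (G : DirectedGraph V E) (T : Set E) (g : G.Pi1 T) :
    G.UniversalCover T → G.UniversalCover T :=
  mapRealization (G.coverGraph T) (G.coverGraph T) (fun v => (g * v.1, v.2))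
    (fun e => (g * e.1, e.2)) (fun _ => rfl)
    (fun e => congrArg (fun h => (h, G.tgt e.2)) (mul_assoc g e.1 (G.theta T e.2)))

open Classical in
/-- The chosen lift `x̃` of a point `x`: the vertex `Ṽ` if `x` is a vertex `V`, and the point of
`Ẽ` over `x` if `x` is in the interior of an edge `E`. -/
noncomputable def liftPoint (G : DirectedGraph V E) (T : Set E) :
    G.Realization → G.UniversalCover T :=
  Quot.lift
    (fun c => match c with
      | Sum.inl v => (G.coverGraph T).vertex (1, v)
      | Sum.inr ⟨e, t⟩ =>
          if t = 0 then (G.coverGraph T).vertex (1, G.src e)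
          else if t = 1 then (G.coverGraph T).vertex (1, G.tgt e)
          else (G.coverGraph T).point (1, e) t)
    (by
      rintro _ _ (e | e)
      · simp
      · simp)

end UniversalCover

section RotationElements

variable {V E : Type*}

/-- `f` permutes the vertices. -/
def IsVertexMap (G : DirectedGraph V E) (f : C(G.Realization, G.Realization)) : Prop :=
  ∃ σ : Equiv.Perm V, ∀ v, f (G.vertex v) = G.vertex (σ v)

/-- `f` is homotopic to the identity, and `F` is a lift of `f` to the universal cover at which
the lift of such a homotopy, starting at the identity, ends. -/
def IsHomotopyLift (G : DirectedGraph V E) (T : Set E) (f : C(G.Realization, G.Realization))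
    (F : C(G.UniversalCover T, G.UniversalCover T)) : Prop :=
  ∃ (H : ContinuousMap.Homotopy (ContinuousMap.id G.Realization) f)
    (H' : ContinuousMap.Homotopy (ContinuousMap.id (G.UniversalCover T)) F),
    ∀ t x, G.proj T (H' (t, x)) = H (t, G.proj T x)

/-- `(v, m)` and `(w, n)` give the same formal root `v^{1/m} = w^{1/n}`. This is the equivalence
relation generated by `(v^a)^{1/(m a)} = v^{1/m}` for positive integers `a`. -/
def rootSetoid (A : Type*) [Group A] : Setoid (A × ℕ+) where
  r x y := ∃ a b : ℕ+, x.1 ^ (a : ℕ) = y.1 ^ (b : ℕ) ∧ x.2 * a = y.2 * b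
  iseqv :=
    { refl := fun _ => ⟨1, 1, rfl, rfl⟩
      symm := fun ⟨a, b, h, k⟩ => ⟨b, a, h.symm, k.symm⟩
      trans := by
        rintro ⟨u, l⟩ ⟨v, m⟩ ⟨w, n⟩ ⟨a, b, h, k⟩ ⟨c, d, h', k'⟩
        refine ⟨a * c, d * b, ?_, ?_⟩
        · simp only [PNat.mul_coe] at *
          rw [pow_mul, h, ← pow_mul, mul_comm, pow_mul, h', ← pow_mul]
        · simp only at *
          rw [← mul_assoc, k, mul_right_comm, k', mul_assoc] }

/-- The formal roots `w^{1/n}` of elements of a group. -/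
def FormalRoot (A : Type*) [Group A] : Type _ := Quotient (rootSetoid A)

/-- The formal root `w^{1/n}`. -/
def root {A : Type*} [Group A] (w : A) (n : ℕ+) : FormalRoot A := Quotient.mk (rootSetoid A) (w, n)

/-- `ρ` is the rotation element of `x` with respect to the lift `F` of `f`: `x` is fixed by `f^n`
for some `n ≥ 1`, and `ρ = w^{1/n}`, where `F^n x̃ = w x̃`. -/
def HasRotationElement (G : DirectedGraph V E) (T : Set E) (f : C(G.Realization, G.Realization))
    (F : C(G.UniversalCover T, G.UniversalCover T)) (x : G.Realization)
    (ρ : FormalRoot (G.Pi1 T)) : Prop :=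
  ∃ n : ℕ+, Function.IsPeriodicPt f n x ∧ ∃ w : G.Pi1 T,
    F^[n] (G.liftPoint T x) = G.deck T w (G.liftPoint T x) ∧ ρ = root w n

/-- `γ` is an initial subword of `w` (possibly empty, possibly all of `w`): the reduced word of
`w` begins with a word for `γ`. -/
def IsInitialSubword {α : Type*} (γ w : FreeGroup α) : Prop :=
  ∃ L M : List (α × Bool),
    FreeGroup.IsReduced (L ++ M) ∧ FreeGroup.mk (L ++ M) = w ∧ FreeGroup.mk L = γ

end RotationElements

end DirectedGraph

/-!
The proof is an intermediate value argument on the tree `G.UniversalCover T`.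

A lift `F` of a map homotopic to the identity along a lifted homotopy commutes with the covering
transformations (`IsHomotopyLift.apply_deck`), because the projection is separated and locally
injective, so that paths lift uniquely. Hence there is one number `q` of iterations, which may be
taken divisible by the denominator of `r`, such that `Φ = F^q` moves the initial vertex of the lift
`(1, e)` of `e` by `w ^ A` and its terminal vertex by `w ^ B`, and `p = r q` is an integer between
`A` and `B`. If `p = A` or `p = B`, the corresponding vertex is the periodic point, with `γ = 1`.

Otherwise some lift `(w ^ p γ, e)` of `e` separates these two images, where `γ` is an initial subword
of `w` (`Belongs.exists_coverSide`). To see this, write the reduced word of `w` as `u c u⁻¹` with `c`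
cyclically reduced. The axis of `w` runs through the copies of `T` at `u c'` for the initial subwords
`c'` of `c`, and enters and leaves each of them along consecutive letters of the cyclic word `c`. If
it never crossed a lift of `e`, then `c` would be represented by an edge loop without `e`, and so
would be a cyclic reduction of a loop that represents `w` (`Belongs.exists_split`). The side of the
lift `(γ, e)` on which a vertex `(g, v)` lies is read off from the first letter of the reduced word
of `γ⁻¹ g` (`CoverSide`, `coverSide_src_iff_tgt`).

Finally, collapsing the rest of the tree turns the path `t ↦ Φ (1, e, t)` into a real function `h`
such that `h t = t` only if `Φ` takes the point with coordinate `t` on `(1, e)` to the point with the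
same coordinate on `(w ^ p γ, e)`. As `h` is at most `0` at one end and at least `1` at the other,
such a `t` exists, whichever way the path crosses (`exists_eq_point_of_separated`).
-/

namespace DirectedGraph

/-! ### Points of the graph and functions on it -/

section Points

variable {V E V' E' : Type*}

/-- A function on a graph is continuous as soon as it is continuous along every edge. -/
theorem continuous_of_continuous_point {X : Type*} [TopologicalSpace X] (G : DirectedGraph V E)
    {φ : G.Realization → X} (h : ∀ e, Continuous fun t => φ (G.point e t)) : Continuous φ := by
  let : TopologicalSpace V := ⊥
  refine continuous_coinduced_dom.2 ?_
  have key : Continuous (φ ∘ Quot.mk G.Glue : V ⊕ (Σ _ : E, unitInterval) → X) :=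
    continuous_sum_dom.2 ⟨continuous_bot, continuous_sigma h⟩
  exact key

theorem continuous_point (G : DirectedGraph V E) (e : E) : Continuous (G.point e) := by
  let : TopologicalSpace V := ⊥
  have key : Continuous (fun t => Sum.inr ⟨e, t⟩ : unitInterval → V ⊕ (Σ _ : E, unitInterval)) :=
    continuous_inr.comp continuous_sigmaMk
  exact Continuous.comp (Y := G.Cells) continuous_quot_mk key

theorem continuous_mapRealization (G : DirectedGraph V E) (G' : DirectedGraph V' E') (φ : V → V')
    (ψ : E → E') (hs : ∀ e, G'.src (ψ e) = φ (G.src e)) (ht : ∀ e, G'.tgt (ψ e) = φ (G.tgt e)) :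
    Continuous (mapRealization G G' φ ψ hs ht) :=
  G.continuous_of_continuous_point fun e => G'.continuous_point (ψ e)

theorem eq_vertex_or_eq_point (G : DirectedGraph V E) (x : G.Realization) :
    (∃ v, x = G.vertex v) ∨ ∃ e t, 0 < t ∧ t < 1 ∧ x = G.point e t := by
  induction x using Quot.ind with
  | mk c =>
    rcases c with v | ⟨e, t⟩
    · exact Or.inl ⟨v, rfl⟩
    · rcases eq_or_lt_of_le (unitInterval.nonneg' : 0 ≤ t) with rfl | h0
      · exact Or.inl ⟨_, G.point_zero e⟩
      · rcases eq_or_lt_of_le (unitInterval.le_one' : t ≤ 1) with rfl | h1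
        · exact Or.inl ⟨_, G.point_one e⟩
        · exact Or.inr ⟨e, t, h0, h1, rfl⟩

open Classical in
/-- The unique cell containing a point: a vertex, or an edge together with an interior
coordinate. -/
noncomputable def cell (G : DirectedGraph V E) : G.Realization → V ⊕ E × unitInterval :=
  Quot.lift
    (fun c => match c with
      | Sum.inl v => Sum.inl v
      | Sum.inr ⟨e, t⟩ =>
          if t = 0 then Sum.inl (G.src e) else if t = 1 then Sum.inl (G.tgt e) else Sum.inr (e, t))
    (by rintro _ _ (e | e) <;> simp)

theorem cell_vertex (G : DirectedGraph V E) (v : V) : G.cell (G.vertex v) = Sum.inl v := rfl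

theorem cell_point (G : DirectedGraph V E) (e : E) {t : unitInterval} (h0 : 0 < t) (h1 : t < 1) :
    G.cell (G.point e t) = Sum.inr (e, t) := by
  change (if t = 0 then _ else if t = 1 then _ else _) = _
  rw [if_neg h0.ne', if_neg h1.ne]

/-- The extension of a function on the vertices which is affine on every edge. -/
noncomputable def affineExt (G : DirectedGraph V E) (h : V → ℝ) : G.Realization → ℝ :=
  Quot.lift
    (fun c => match c with
      | Sum.inl v => h v
      | Sum.inr ⟨e, t⟩ => (1 - (t : ℝ)) * h (G.src e) + t * h (G.tgt e))
    (by rintro _ _ (e | e) <;> simp)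

theorem affineExt_vertex (G : DirectedGraph V E) (h : V → ℝ) (v : V) :
    G.affineExt h (G.vertex v) = h v := rfl

theorem affineExt_point (G : DirectedGraph V E) (h : V → ℝ) (e : E) (t : unitInterval) :
    G.affineExt h (G.point e t) = (1 - (t : ℝ)) * h (G.src e) + t * h (G.tgt e) := rfl

theorem continuous_affineExt (G : DirectedGraph V E) (h : V → ℝ) : Continuous (G.affineExt h) :=
  G.continuous_of_continuous_point fun e => by
    simp only [affineExt_point]
    fun_prop

open Classical in
/-- The open star of a vertex: the vertex, and the interiors of the edges at it. -/
def star (G : DirectedGraph V E) (v : V) : Set G.Realization :=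
  {x | 0 < G.affineExt (Pi.single v 1) x}

theorem isOpen_star (G : DirectedGraph V E) (v : V) : IsOpen (G.star v) := by
  classical
  exact isOpen_lt continuous_const (G.continuous_affineExt _)

theorem vertex_mem_star (G : DirectedGraph V E) {u v : V} : G.vertex u ∈ G.star v ↔ u = v := by
  classical
  by_cases h : u = v <;> simp [star, affineExt_vertex, h]

theorem point_mem_star (G : DirectedGraph V E) {e : E} {t : unitInterval} (h0 : 0 < t) (h1 : t < 1)
    {v : V} : G.point e t ∈ G.star v ↔ G.src e = v ∨ G.tgt e = v := by
  classical
  have h0' : (0 : ℝ) < t := h0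
  have h1' : (t : ℝ) < 1 := h1
  by_cases hs : G.src e = v <;> by_cases ht : G.tgt e = v <;>
    simp [star, affineExt_point, hs, ht, h0, h1']

end Points

/-! ### Unique path lifting -/

section Lifting

variable {V E : Type*} (G : DirectedGraph V E) (T : Set E)

theorem proj_vertex (v : G.Pi1 T × V) : G.proj T ((G.coverGraph T).vertex v) = G.vertex v.2 := rfl

theorem proj_point (d : G.Pi1 T × E) (t : unitInterval) :
    G.proj T ((G.coverGraph T).point d t) = G.point d.2 t := rfl

theorem deck_vertex (g : G.Pi1 T) (v : G.Pi1 T × V) :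
    G.deck T g ((G.coverGraph T).vertex v) = (G.coverGraph T).vertex (g * v.1, v.2) := rfl

theorem deck_point (g : G.Pi1 T) (d : G.Pi1 T × E) (t : unitInterval) :
    G.deck T g ((G.coverGraph T).point d t) = (G.coverGraph T).point (g * d.1, d.2) t := rfl

theorem continuous_deck (g : G.Pi1 T) : Continuous (G.deck T g) :=
  continuous_mapRealization ..

theorem deck_deck (g h : G.Pi1 T) (x : G.UniversalCover T) :
    G.deck T g (G.deck T h x) = G.deck T (g * h) x := by
  rcases (G.coverGraph T).eq_vertex_or_eq_point x with ⟨v, rfl⟩ | ⟨d, t, -, -, rfl⟩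
  · simp only [deck_vertex, mul_assoc]
  · simp only [deck_point, mul_assoc]

theorem proj_deck (g : G.Pi1 T) (x : G.UniversalCover T) :
    G.proj T (G.deck T g x) = G.proj T x := by
  rcases (G.coverGraph T).eq_vertex_or_eq_point x with ⟨v, rfl⟩ | ⟨d, t, -, -, rfl⟩ <;> rfl

theorem exists_mem_star (x : G.UniversalCover T) : ∃ v, x ∈ (G.coverGraph T).star v := by
  rcases (G.coverGraph T).eq_vertex_or_eq_point x with ⟨v, rfl⟩ | ⟨d, t, h0, h1, rfl⟩
  · exact ⟨v, (vertex_mem_star _).2 rfl⟩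
  · exact ⟨_, (point_mem_star _ h0 h1).2 (Or.inl rfl)⟩

theorem point_mem_star_coverGraph {a g : G.Pi1 T} {d : E} {v : V} {t : unitInterval} (h0 : 0 < t)
    (h1 : t < 1) : (G.coverGraph T).point (a, d) t ∈ (G.coverGraph T).star (g, v) ↔
      a = g ∧ G.src d = v ∨ a * G.theta T d = g ∧ G.tgt d = v := by
  rw [point_mem_star _ h0 h1]
  exact or_congr Prod.mk_inj Prod.mk_inj

/-- Two points over the same point of the graph lie in stars of vertices over the same vertex, and
they agree if these are the same star. -/
theorem exists_mem_star_of_proj_eq {x y : G.UniversalCover T} (h : G.proj T x = G.proj T y)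
    {g : G.Pi1 T} {v : V} (hx : x ∈ (G.coverGraph T).star (g, v)) :
    ∃ g', y ∈ (G.coverGraph T).star (g', v) ∧ (g' = g → x = y) := by
  have hc := congrArg G.cell h
  rcases (G.coverGraph T).eq_vertex_or_eq_point x with ⟨⟨a, u⟩, rfl⟩ | ⟨⟨a, d⟩, t, h0, h1, rfl⟩ <;>
    rcases (G.coverGraph T).eq_vertex_or_eq_point y with
      ⟨⟨a', u'⟩, rfl⟩ | ⟨⟨a', d'⟩, t', h0', h1', rfl⟩
  · rw [proj_vertex, proj_vertex, cell_vertex, cell_vertex] at hc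
    rw [vertex_mem_star] at hx
    obtain rfl : u = u' := Sum.inl_injective hc
    cases hx
    exact ⟨a', (vertex_mem_star _).2 rfl, fun h => by rw [h]⟩
  · rw [proj_vertex, proj_point, cell_vertex, cell_point _ _ h0' h1'] at hc
    cases hc
  · rw [proj_vertex, proj_point, cell_vertex, cell_point _ _ h0 h1] at hc
    cases hc
  · rw [proj_point, proj_point, cell_point _ _ h0 h1, cell_point _ _ h0' h1'] at hc
    obtain ⟨rfl, rfl⟩ := Prod.mk_inj.1 (Sum.inr_injective hc)
    simp only [point_mem_star_coverGraph G T h0 h1] at hx ⊢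
    rcases hx with ⟨rfl, rfl⟩ | ⟨rfl, rfl⟩
    · exact ⟨a', Or.inl ⟨rfl, rfl⟩, fun h => by rw [h]⟩
    · exact ⟨_, Or.inr ⟨rfl, rfl⟩, fun h => by rw [mul_right_cancel h]⟩

/-- Since there are no loops, the stars of different vertices over the same vertex are disjoint. -/
theorem eq_of_mem_star {x : G.UniversalCover T} {g g' : G.Pi1 T} {v : V}
    (hx : x ∈ (G.coverGraph T).star (g, v)) (hx' : x ∈ (G.coverGraph T).star (g', v)) :
    g = g' := by
  rcases (G.coverGraph T).eq_vertex_or_eq_point x with ⟨⟨a, u⟩, rfl⟩ | ⟨⟨a, d⟩, t, h0, h1, rfl⟩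
  · rw [vertex_mem_star] at hx hx'
    exact congrArg Prod.fst (hx.symm.trans hx')
  · have hd := G.no_loops d
    rw [point_mem_star_coverGraph G T h0 h1] at hx hx'
    rcases hx with ⟨rfl, rfl⟩ | ⟨rfl, rfl⟩ <;> rcases hx' with ⟨rfl, hv⟩ | ⟨rfl, hv⟩
    · rfl
    · exact absurd hv.symm hd
    · exact absurd hv hd
    · rfl

theorem isLocallyInjective_proj : IsLocallyInjective (G.proj T) := by
  intro x
  obtain ⟨⟨g, v⟩, hx⟩ := G.exists_mem_star T x
  refine ⟨_, isOpen_star _ _, hx, fun y hy z hz h => ?_⟩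
  obtain ⟨g', hz', hg⟩ := G.exists_mem_star_of_proj_eq T h hy
  exact hg (G.eq_of_mem_star T hz' hz)

theorem isSeparatedMap_proj : IsSeparatedMap (G.proj T) := by
  intro x y h hne
  obtain ⟨⟨g, v⟩, hx⟩ := G.exists_mem_star T x
  obtain ⟨g', hy, hg⟩ := G.exists_mem_star_of_proj_eq T h hx
  refine ⟨_, _, isOpen_star _ _, isOpen_star _ _, hx, hy, Set.disjoint_left.2 fun z hz hz' => ?_⟩
  exact hne (hg (G.eq_of_mem_star T hz' hz))

variable {G T}

/-- A lift of a homotopy starting at the identity commutes with the covering transformations, by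
uniqueness of path lifting. -/
theorem IsHomotopyLift.apply_deck {f : C(G.Realization, G.Realization)}
    {F : C(G.UniversalCover T, G.UniversalCover T)} (hF : G.IsHomotopyLift T f F) (g : G.Pi1 T)
    (x : G.UniversalCover T) : F (G.deck T g x) = G.deck T g (F x) := by
  obtain ⟨H, H', hH⟩ := hF
  have key : (fun t => H' (t, G.deck T g x)) = fun t => G.deck T g (H' (t, x)) := by
    refine (G.isSeparatedMap_proj T).eq_of_comp_eq (G.isLocallyInjective_proj T) (by fun_prop)
      ((G.continuous_deck T g).comp (by fun_prop)) ?_ 0 (by simp)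
    funext t
    simp only [Function.comp_apply, hH, proj_deck]
  simpa using congrFun key 1

theorem IsHomotopyLift.iterate_deck {f : C(G.Realization, G.Realization)}
    {F : C(G.UniversalCover T, G.UniversalCover T)} (hF : G.IsHomotopyLift T f F) (g : G.Pi1 T)
    (n : ℕ) (x : G.UniversalCover T) : F^[n] (G.deck T g x) = G.deck T g (F^[n] x) := by
  have h : Function.Semiconj (G.deck T g) F F := fun x => (hF.apply_deck g x).symm
  exact (h.iterate_right n x).symm

theorem IsHomotopyLift.proj_iterate {f : C(G.Realization, G.Realization)}
    {F : C(G.UniversalCover T, G.UniversalCover T)} (hF : G.IsHomotopyLift T f F)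
    (n : ℕ) (x : G.UniversalCover T) : G.proj T (F^[n] x) = f^[n] (G.proj T x) := by
  have h : Function.Semiconj (G.proj T) F f := fun x => by
    obtain ⟨H, H', hH⟩ := hF
    simpa using hH 1 x
  exact h.iterate_right n x

/-- If `F^n x = g x`, then `F^(n k) x = g^k x`. -/
theorem IsHomotopyLift.iterate_mul {f : C(G.Realization, G.Realization)}
    {F : C(G.UniversalCover T, G.UniversalCover T)} (hF : G.IsHomotopyLift T f F) {n : ℕ}
    {g : G.Pi1 T} {x : G.UniversalCover T} (h : F^[n] x = G.deck T g x) (k : ℕ) :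
    F^[n * k] x = G.deck T (g ^ k) x := by
  induction k with
  | zero =>
    rcases (G.coverGraph T).eq_vertex_or_eq_point x with ⟨v, rfl⟩ | ⟨d, t, -, -, rfl⟩
    · simp [deck_vertex]
    · simp [deck_point]
  | succ k ih =>
    rw [Nat.mul_succ, Function.iterate_add_apply, h, hF.iterate_deck, ih, deck_deck, pow_succ']

end Lifting

/-! ### Edge paths -/

section Paths

variable {V E : Type*} {G : DirectedGraph V E} {T : Set E}

theorem IsEdgePath.append {u v x : V} {P Q : List (E × Bool)} (hP : G.IsEdgePath u P v)
    (hQ : G.IsEdgePath v Q x) : G.IsEdgePath u (P ++ Q) x := by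
  induction P generalizing u with
  | nil => cases hP; exact hQ
  | cons d P ih => exact ⟨hP.1, ih hP.2⟩

theorem exists_isEdgePath_of_append {u x : V} {P Q : List (E × Bool)}
    (h : G.IsEdgePath u (P ++ Q) x) : ∃ v, G.IsEdgePath u P v ∧ G.IsEdgePath v Q x := by
  induction P generalizing u with
  | nil => exact ⟨u, rfl, h⟩
  | cons d P ih =>
    obtain ⟨v, hP, hQ⟩ := ih h.2
    exact ⟨v, ⟨h.1, hP⟩, hQ⟩

theorem start_not (d : E) (b : Bool) : G.start (d, !b) = G.finish (d, b) := by
  cases b <;> rfl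

theorem finish_not (d : E) (b : Bool) : G.finish (d, !b) = G.start (d, b) := by
  cases b <;> rfl

theorem IsEdgePath.invRev {u v : V} {P : List (E × Bool)} (hP : G.IsEdgePath u P v) :
    G.IsEdgePath v (FreeGroup.invRev P) u := by
  induction P generalizing u with
  | nil => exact Eq.symm hP
  | cons d P ih =>
    rw [FreeGroup.invRev_cons]
    exact (ih hP.2).append ⟨start_not _ _, (finish_not _ _).trans hP.1⟩

theorem IsEdgePath.red {u v : V} {P Q : List (E × Bool)} (hP : G.IsEdgePath u P v)
    (h : FreeGroup.Red P Q) : G.IsEdgePath u Q v := by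
  induction h with
  | refl => exact hP
  | tail _ hstep ih =>
    obtain @⟨A, B, x, b⟩ := hstep
    obtain ⟨y, hA, h₁, h₂, hB⟩ := exists_isEdgePath_of_append ih
    rw [finish_not, h₁] at hB
    exact hA.append hB

theorem mem_invRev_iff {α : Type*} {L : List (α × Bool)} {d : α} {b : Bool} :
    (d, b) ∈ FreeGroup.invRev L ↔ (d, !b) ∈ L := by
  simp only [FreeGroup.invRev, List.mem_reverse, List.mem_map, Prod.mk.injEq, Prod.exists]
  constructor
  · rintro ⟨a, c, h, rfl, rfl⟩
    simpa using h
  · exact fun h => ⟨d, !b, h, rfl, by simp⟩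

theorem loopClass_append (P Q : List (E × Bool)) :
    G.loopClass T (P ++ Q) = G.loopClass T P * G.loopClass T Q := by
  rw [loopClass, ← FreeGroup.mul_mk, map_mul]
  rfl

theorem loopClass_invRev (P : List (E × Bool)) :
    G.loopClass T (FreeGroup.invRev P) = (G.loopClass T P)⁻¹ := by
  rw [loopClass, ← FreeGroup.inv_mk, map_inv]
  rfl

theorem loopClass_eq_one {P : List (E × Bool)} (h : ∀ d ∈ P, d.1 ∈ T) : G.loopClass T P = 1 := by
  induction P with
  | nil => exact map_one _
  | cons d P ih =>
    rw [List.forall_mem_cons] at h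
    rw [← List.singleton_append, loopClass_append, ih h.2]
    rcases d with ⟨d, _ | _⟩ <;> simp [loopClass, theta, h.1]

/-- A letter of a word in the generators of the fundamental group, as an oriented edge. -/
def letterEdge (x : {e : E // e ∉ T} × Bool) : E × Bool := (x.1, x.2)

theorem loopClass_letterEdge (x : {e : E // e ∉ T} × Bool) :
    G.loopClass T [letterEdge x] = FreeGroup.mk [x] := by
  rcases x with ⟨⟨d, hd⟩, _ | _⟩
  · simp [loopClass, theta, letterEdge, hd, FreeGroup.of, FreeGroup.inv_mk, FreeGroup.invRev]
  · simp [loopClass, theta, letterEdge, hd, FreeGroup.of]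

/-- Any element of the fundamental group is represented by an edge path between any two given
vertices. -/
theorem exists_isEdgePath_loopClass (hT : G.IsSpanningTree T)
    (L : List ({e : E // e ∉ T} × Bool)) (u v : V) :
    ∃ P, G.IsEdgePath u P v ∧ G.loopClass T P = FreeGroup.mk L := by
  induction L generalizing u with
  | nil =>
    obtain ⟨P, hP, -⟩ := hT u v
    exact ⟨P, hP.1, loopClass_eq_one hP.2.2⟩
  | cons x L ih =>
    obtain ⟨P, hP, -⟩ := hT u (G.start (letterEdge x))
    obtain ⟨Q, hQ, hL⟩ := ih (G.finish (letterEdge x))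
    refine ⟨P ++ ([letterEdge x] ++ Q), hP.1.append ⟨rfl, hQ⟩, ?_⟩
    rw [loopClass_append, loopClass_append, loopClass_eq_one hP.2.2, hL, loopClass_letterEdge,
      FreeGroup.mul_mk, one_mul, List.singleton_append]

theorem reflTransGen_conj {α : Type*} (A C : List (α × Bool)) :
    Relation.ReflTransGen (fun A B => FreeGroup.Red.Step A B ∨ A.IsRotated B)
      (A ++ C ++ FreeGroup.invRev A) C := by
  classical
  have h : FreeGroup.Red (C ++ (FreeGroup.invRev A ++ A)) (C ++ []) :=
    FreeGroup.Red.append_append Relation.ReflTransGen.refl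
      (FreeGroup.reduce_invRev_left_cancel (L := A) ▸ FreeGroup.reduce.red)
  rw [List.append_nil] at h
  refine .head (Or.inr ?_) (Relation.ReflTransGen.mono (fun _ _ => Or.inl) _ _ h)
  rw [List.append_assoc, ← List.append_assoc C]
  exact List.isRotated_append

/-- A word has a cyclic reduction all of whose letters occur in the word. -/
theorem exists_isCyclicReduction {α : Type*} (P : List (α × Bool)) :
    ∃ Q, IsCyclicReduction P Q ∧ Q ⊆ P := by
  classical
  have hred : FreeGroup.Red P (FreeGroup.reduce P) := FreeGroup.reduce.red
  have hR := FreeGroup.IsReduced.of_reduce_eq (FreeGroup.reduce.idem (L := P))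
  have heq := FreeGroup.reduceCyclically.conj_conjugator_reduceCyclically (FreeGroup.reduce P)
  refine ⟨_, ⟨FreeGroup.reduceCyclically.isCyclicallyReduced hR,
    .trans (Relation.ReflTransGen.mono (fun _ _ => Or.inl) _ _ hred) ?_⟩,
    List.Subset.trans ?_ hred.sublist.subset⟩
  · conv_lhs => rw [← heq]
    exact reflTransGen_conj _ _
  · conv_rhs => rw [← heq]
    exact fun d hd => by simp [hd]

end Paths

/-! ### The two sides of an edge -/

section Sides

variable {V E : Type*} (G : DirectedGraph V E) (T : Set E) (e : E)

/-- The vertices `u` and `v` are joined by an edge path in `T` that avoids the edge `e`. -/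
def JoinedOff (u v : V) : Prop := ∃ P, G.IsEdgePath u P v ∧ ∀ d ∈ P, d.1 ∈ T ∧ d.1 ≠ e

/-- The vertex `v` lies on the initial side of `e`, i.e. in the component of `T ∖ e` that contains
the initial vertex of `e`. -/
def IsInitialSide (v : V) : Prop := G.JoinedOff T e (G.src e) v

variable {G T e}

theorem JoinedOff.refl (u : V) : G.JoinedOff T e u u := ⟨[], rfl, by simp⟩

theorem JoinedOff.symm {u v : V} (h : G.JoinedOff T e u v) : G.JoinedOff T e v u := by
  obtain ⟨P, hP, hd⟩ := h
  exact ⟨_, hP.invRev, fun d h => hd (d.1, !d.2) (mem_invRev_iff.1 h)⟩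

theorem JoinedOff.trans {u v x : V} (h : G.JoinedOff T e u v) (h' : G.JoinedOff T e v x) :
    G.JoinedOff T e u x := by
  obtain ⟨P, hP, hd⟩ := h
  obtain ⟨Q, hQ, hd'⟩ := h'
  refine ⟨P ++ Q, hP.append hQ, fun d h => ?_⟩
  exact (List.mem_append.1 h).elim (hd d) (hd' d)

theorem joinedOff_start_finish {d : E × Bool} (hd : d.1 ∈ T) (hne : d.1 ≠ e) :
    G.JoinedOff T e (G.start d) (G.finish d) :=
  ⟨[d], ⟨rfl, rfl⟩, by simpa using ⟨hd, hne⟩⟩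

theorem isInitialSide_src : G.IsInitialSide T e (G.src e) := JoinedOff.refl _

theorem not_isInitialSide_tgt (hT : G.IsSpanningTree T) (he : e ∈ T) :
    ¬ G.IsInitialSide T e (G.tgt e) := by
  classical
  rintro ⟨P, hP, hd⟩
  have hred : FreeGroup.Red P (FreeGroup.reduce P) := FreeGroup.reduce.red
  have hsub := hred.sublist.subset
  have h := (hT (G.src e) (G.tgt e)).unique
    ⟨hP.red hred, .of_reduce_eq FreeGroup.reduce.idem, fun d h => (hd d (hsub h)).1⟩
    (y₂ := [(e, true)]) ⟨⟨rfl, rfl⟩, by simp, by simpa using he⟩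
  exact (hd (e, true) (hsub (by simp [h]))).2 rfl

theorem isInitialSide_src_iff_tgt {d : E} (hd : d ∈ T) (hne : d ≠ e) :
    G.IsInitialSide T e (G.src d) ↔ G.IsInitialSide T e (G.tgt d) :=
  have h : G.JoinedOff T e (G.src d) (G.tgt d) := joinedOff_start_finish (d := (d, true)) hd hne
  ⟨fun h' => h'.trans h, fun h' => h'.trans h.symm⟩

theorem joinedOff_src_or_tgt (hT : G.IsSpanningTree T) (v : V) :
    G.JoinedOff T e v (G.src e) ∨ G.JoinedOff T e v (G.tgt e) := by
  obtain ⟨P, ⟨hP, -, hPT⟩, -⟩ := hT v (G.src e)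
  clear hT
  induction P generalizing v with
  | nil => cases hP; exact Or.inl (.refl _)
  | cons d P ih =>
    rw [List.forall_mem_cons] at hPT
    obtain ⟨rfl, hP⟩ := hP
    rcases eq_or_ne d.1 e with rfl | hne
    · rcases d with ⟨d, _ | _⟩
      exacts [Or.inr (.refl _), Or.inl (.refl _)]
    · have h := joinedOff_start_finish (G := G) hPT.1 hne
      exact (ih _ hP hPT.2).imp h.trans h.trans

theorem joinedOff_of_isInitialSide_iff (hT : G.IsSpanningTree T) {u v : V}
    (h : G.IsInitialSide T e u ↔ G.IsInitialSide T e v) : G.JoinedOff T e u v := by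
  by_cases hu : G.IsInitialSide T e u
  · exact hu.symm.trans (h.1 hu)
  · have hv : ¬ G.IsInitialSide T e v := fun hv => hu (h.2 hv)
    have hu' := (joinedOff_src_or_tgt (e := e) hT u).resolve_left fun h => hu h.symm
    have hv' := (joinedOff_src_or_tgt (e := e) hT v).resolve_left fun h => hv h.symm
    exact hu'.trans hv'.symm

variable (G T e)

/-- The side of the lift `(1, e)` of `e` on which the vertex `(g, v)` of the universal cover lies,
where `L` is the reduced word of `g`: if `g ≠ 1`, the path from the copy of `T` at `1` to that
vertex leaves this copy along the first letter of `L`. -/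
def WordSide (L : List ({e : E // e ∉ T} × Bool)) (v : V) : Prop :=
  match L with
  | [] => G.IsInitialSide T e v
  | x :: _ => G.IsInitialSide T e (G.start (letterEdge x))

open Classical in
/-- The vertex `a` of the universal cover lies on the initial side of the edge `(γ, e)`. -/
def CoverSide (γ : G.Pi1 T) (a : G.Pi1 T × V) : Prop := G.WordSide T e (γ⁻¹ * a.1).toWord a.2

variable {G T e}

theorem wordSide_append_singleton (L : List ({e : E // e ∉ T} × Bool))
    (x : {e : E // e ∉ T} × Bool) (v : V) :
    G.WordSide T e (L ++ [x]) v ↔ G.WordSide T e L (G.start (letterEdge x)) := by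
  cases L <;> rfl

theorem toWord_mul_of {α : Type*} [DecidableEq α] (g : FreeGroup α) (a : α) :
    (g * FreeGroup.of a).toWord = g.toWord ++ [(a, true)] ∨
      g.toWord = (g * FreeGroup.of a).toWord ++ [(a, false)] := by
  have hg : FreeGroup.IsReduced g.toWord := FreeGroup.isReduced_toWord
  rcases g.toWord.eq_nil_or_concat with hL | ⟨L, ⟨b, c⟩, hL⟩
  · left
    rw [FreeGroup.toWord_mul, FreeGroup.toWord_of, hL]
    exact FreeGroup.reduce_singleton _
  · rw [List.concat_eq_append] at hL
    by_cases hb : b = a ∧ c = false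
    · right
      obtain ⟨rfl, rfl⟩ := hb
      have hgL : g * FreeGroup.of b = FreeGroup.mk L := by
        rw [← FreeGroup.mk_toWord (x := g), hL, ← FreeGroup.mul_mk, mul_assoc]
        have : (FreeGroup.mk [(b, false)]) = (FreeGroup.of b)⁻¹ := rfl
        rw [this, inv_mul_cancel, mul_one]
      have hLr : FreeGroup.IsReduced L := by
        rw [hL] at hg
        exact hg.infix ⟨[], _, rfl⟩
      rw [hgL, FreeGroup.toWord_mk, hLr.reduce_eq, hL]
    · left
      rw [FreeGroup.toWord_mul, FreeGroup.toWord_of]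
      refine FreeGroup.IsReduced.reduce_eq ?_
      refine List.isChain_append.2 ⟨hg, List.isChain_singleton _, ?_⟩
      rw [hL]
      rintro _ hx _ hy
      simp only [List.getLast?_append, List.getLast?_singleton, Option.some_or, Option.mem_def,
        Option.some.injEq, List.head?_cons] at hx hy
      subst hx hy
      grind

/-- The only edge of the universal cover that joins the two sides of `(γ, e)` is `(γ, e)`. -/
theorem coverSide_src_iff_tgt (γ : G.Pi1 T) {d : G.Pi1 T × E} (hd : d ≠ (γ, e)) :
    G.CoverSide T e γ ((G.coverGraph T).src d) ↔ G.CoverSide T e γ ((G.coverGraph T).tgt d) := by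
  classical
  rcases d with ⟨g, d⟩
  change G.WordSide T e (γ⁻¹ * g).toWord (G.src d) ↔
    G.WordSide T e (γ⁻¹ * (g * G.theta T d)).toWord (G.tgt d)
  rw [← mul_assoc]
  by_cases hT : d ∈ T
  · simp only [theta, hT, dite_true, mul_one]
    cases hL : (γ⁻¹ * g).toWord with
    | cons x L => rfl
    | nil =>
      have hg : γ = g := inv_mul_eq_one.1 (FreeGroup.toWord_eq_nil_iff.1 hL)
      exact isInitialSide_src_iff_tgt hT fun h => hd (by rw [hg, h])
  · simp only [theta, hT, dite_false]
    rcases toWord_mul_of (γ⁻¹ * g) ⟨d, hT⟩ with h | h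
    · rw [h, wordSide_append_singleton]
      rfl
    · rw [h, wordSide_append_singleton]
      rfl

theorem coverSide_src (γ : G.Pi1 T) : G.CoverSide T e γ (γ, G.src e) := by
  simp [CoverSide, WordSide, isInitialSide_src]

theorem not_coverSide_tgt (hT : G.IsSpanningTree T) (he : e ∈ T) (γ : G.Pi1 T) :
    ¬ G.CoverSide T e γ (γ, G.tgt e) := by
  simp [CoverSide, WordSide, not_isInitialSide_tgt hT he]

end Sides

/-! ### Paths that cross an edge -/

section Crossing

variable {V E : Type*} (G : DirectedGraph V E)

open Classical in
/-- A separating edge `e` gives the height function which is the coordinate on `e`, negative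
elsewhere on the initial side and greater than `1` elsewhere on the terminal side. -/
theorem eq_point_of_affineExt_eq {e : E} {S : V → Prop} (hs : S (G.src e)) (ht : ¬ S (G.tgt e))
    (h : ∀ d ≠ e, S (G.src d) ↔ S (G.tgt d)) {x : G.Realization} {t : unitInterval}
    (hx : G.affineExt (fun v => if v = G.src e then 0 else if v = G.tgt e then 1 else
      if S v then -1 else 2) x = t) : x = G.point e t := by
  have ht0 : (0 : ℝ) ≤ t := t.2.1
  have ht1 : (t : ℝ) ≤ 1 := t.2.2
  have hloop := G.no_loops e
  rcases G.eq_vertex_or_eq_point x with ⟨v, rfl⟩ | ⟨d, s, hs0, hs1, rfl⟩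
  · rw [affineExt_vertex] at hx
    split_ifs at hx with h1 h2 h3
    · obtain rfl : t = 0 := Subtype.ext hx.symm
      rw [h1, point_zero]
    · obtain rfl : t = 1 := Subtype.ext hx.symm
      rw [h2, point_one]
    · linarith
    · linarith
  · rw [affineExt_point] at hx
    have hs0' : (0 : ℝ) < s := hs0
    have hs1' : (s : ℝ) < 1 := hs1
    rcases eq_or_ne d e with rfl | hne
    · rw [if_pos rfl, if_neg hloop.symm, if_pos rfl] at hx
      obtain rfl : s = t := Subtype.ext (by linarith)
      rfl
    · have hd := G.no_loops d
      have hS := h d hne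
      exfalso
      split_ifs at hx <;> first | linarith | simp_all

theorem exists_eq_point_of_separated {e : E} {S : V → Prop} (hs : S (G.src e))
    (ht : ¬ S (G.tgt e)) (h : ∀ d ≠ e, S (G.src d) ↔ S (G.tgt d)) {φ : unitInterval → G.Realization}
    (hφ : Continuous φ) {a b : V} (ha : φ 0 = G.vertex a) (hb : φ 1 = G.vertex b)
    (hab : ¬ (S a ↔ S b)) : ∃ t, φ t = G.point e t := by
  classical
  set k : V → ℝ := fun v => if v = G.src e then 0 else if v = G.tgt e then 1 else
    if S v then -1 else 2 with hk
  have hcont : Continuous fun t : unitInterval => G.affineExt k (φ t) - t :=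
    ((G.continuous_affineExt k).comp hφ).sub continuous_subtype_val
  have hS : ∀ v, S v → k v ≤ 0 := fun v hv => by
    have : v ≠ G.tgt e := fun h => ht (h ▸ hv)
    simp only [hk, this, hv, if_true, if_false]
    split_ifs <;> norm_num
  have hS' : ∀ v, ¬ S v → 1 ≤ k v := fun v hv => by
    have : v ≠ G.src e := fun h => hv (h ▸ hs)
    simp only [hk, this, hv, if_false]
    split_ifs <;> norm_num
  obtain ⟨t, ht'⟩ : (0 : ℝ) ∈ Set.range fun t : unitInterval => G.affineExt k (φ t) - t := by
    by_cases hSa : S a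
    · have hSb : ¬ S b := fun hSb => hab (iff_of_true hSa hSb)
      refine mem_range_of_exists_le_of_exists_ge hcont ⟨0, ?_⟩ ⟨1, ?_⟩
      · simpa [ha, affineExt_vertex] using hS a hSa
      · simpa [hb, affineExt_vertex] using hS' b hSb
    · have hSb : S b := by tauto
      refine mem_range_of_exists_le_of_exists_ge hcont ⟨1, ?_⟩ ⟨0, ?_⟩
      · simpa [hb, affineExt_vertex] using (hS b hSb).trans zero_le_one
      · simpa [ha, affineExt_vertex] using zero_le_one.trans (hS' a hSa)
  exact ⟨t, G.eq_point_of_affineExt_eq hs ht h (sub_eq_zero.1 ht')⟩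

end Crossing

/-! ### The axis of `w` crosses the edge -/

section Axis

variable {V E : Type*} {G : DirectedGraph V E} {T : Set E} {e : E}

/-- If the edges of a word lead from each to the next on the same side of `e`, the word is
represented by an edge path that avoids `e`. -/
theorem exists_isEdgePath_of_isChain (hT : G.IsSpanningTree T) (he : e ∈ T)
    (L : List ({e : E // e ∉ T} × Bool)) (y : {e : E // e ∉ T} × Bool)
    (h : List.IsChain (fun x y => G.IsInitialSide T e (G.finish (letterEdge x)) ↔
      G.IsInitialSide T e (G.start (letterEdge y))) (y :: L)) :
    ∃ P, ∃ x ∈ (y :: L).getLast?,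
      G.IsEdgePath (G.start (letterEdge y)) P (G.finish (letterEdge x)) ∧
      (∀ d ∈ P, d.1 ≠ e) ∧ G.loopClass T P = FreeGroup.mk (y :: L) := by
  have hne : ∀ x : {e : E // e ∉ T} × Bool, (letterEdge x).1 ≠ e :=
    fun x hx => x.1.2 (by rw [← hx] at he; exact he)
  induction L generalizing y with
  | nil => exact ⟨[letterEdge y], y, rfl, ⟨rfl, rfl⟩, by simpa using hne y, loopClass_letterEdge y⟩
  | cons z L ih =>
    rw [List.isChain_cons_cons] at h
    obtain ⟨P, x, hx, hP, hPe, hPL⟩ := ih z h.2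
    obtain ⟨Q, hQ, hQT⟩ := joinedOff_of_isInitialSide_iff hT h.1
    refine ⟨[letterEdge y] ++ (Q ++ P), x, by simpa using hx, IsEdgePath.append ⟨rfl, rfl⟩
      (hQ.append hP), fun d hd => ?_, ?_⟩
    · rcases List.mem_append.1 hd with hd | hd
      · rw [List.mem_singleton.1 hd]
        exact hne y
      · exact (List.mem_append.1 hd).elim (fun h => (hQT d h).2) (hPe d)
    · rw [loopClass_append, loopClass_append, hPL, loopClass_eq_one fun d h => (hQT d h).1,
        loopClass_letterEdge, one_mul, FreeGroup.mul_mk, List.singleton_append]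

/-- If `e` belongs to `w = u c u⁻¹`, then somewhere in the cyclic word `c` a letter leads to one side
of `e` and the next letter starts on the other side. Otherwise `c` would be represented by a loop
that avoids `e`. -/
theorem Belongs.exists_split (hT : G.IsSpanningTree T) (he : e ∈ T) {x₀ : V}
    {U C : List ({e : E // e ∉ T} × Bool)}
    (hw : G.Belongs x₀ T e (FreeGroup.mk (U ++ C ++ FreeGroup.invRev U))) :
    ∃ A B x y, C = A ++ y :: B ∧ x ∈ (C ++ A).getLast? ∧
      ¬ (G.IsInitialSide T e (G.finish (letterEdge x)) ↔
        G.IsInitialSide T e (G.start (letterEdge y))) := by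
  by_contra! hcon
  -- It is enough to find a loop that avoids `e` and represents `C`.
  suffices ∃ v P, G.IsEdgePath v P v ∧ (∀ d ∈ P, d.1 ≠ e) ∧ G.loopClass T P = FreeGroup.mk C by
    obtain ⟨v, P, hP, hPe, hPC⟩ := this
    obtain ⟨A, hA, hAU⟩ := exists_isEdgePath_loopClass hT U x₀ v
    obtain ⟨Q, hQ, hsub⟩ := exists_isCyclicReduction P
    obtain ⟨b, hb⟩ := hw (A ++ P ++ FreeGroup.invRev A) ((hA.append hP).append hA.invRev)
      (by rw [loopClass_append, loopClass_append, loopClass_invRev, hAU, hPC, FreeGroup.inv_mk,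
        FreeGroup.mul_mk, FreeGroup.mul_mk]) Q ⟨hQ.1, (reflTransGen_conj A P).trans hQ.2⟩
    exact hPe _ (hsub hb) rfl
  rcases C with _ | ⟨y, L⟩
  · exact ⟨x₀, [], rfl, by simp, map_one _⟩
  · obtain ⟨P, x, hx, hP, hPe, hPC⟩ := exists_isEdgePath_of_isChain (G := G) hT he L y (by
      rw [List.isChain_iff_forall_rel_of_append_cons_cons]
      intro x z A B h
      exact hcon (A ++ [x]) B x z (by simp [h])
        (List.mem_getLast?_append_of_mem_getLast? (by simp)))
    obtain ⟨Q, hQ, hQT⟩ := joinedOff_of_isInitialSide_iff hT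
      (hcon [] L x y rfl (by simpa using hx))
    refine ⟨_, P ++ Q, hP.append hQ, fun d hd => ?_, ?_⟩
    · exact (List.mem_append.1 hd).elim (hPe d) fun h => (hQT d h).2
    · rw [loopClass_append, hPC, loopClass_eq_one fun d h => (hQT d h).1, mul_one]

/-- If `e` belongs to `w`, some lift of `e` at an initial subword of `w` separates the vertices in
the copies of `T` at positive powers of `w` from those at negative powers. -/
theorem Belongs.exists_coverSide (hT : G.IsSpanningTree T) (he : e ∈ T) {x₀ : V} {w : G.Pi1 T}
    (hw : G.Belongs x₀ T e w) : ∃ γ, IsInitialSubword γ w ∧ ∀ k l : ℕ, ∀ u v,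
      ¬ (G.CoverSide T e γ ((w ^ (l + 1))⁻¹, u) ↔ G.CoverSide T e γ (w ^ (k + 1), v)) := by
  classical
  set U := FreeGroup.reduceCyclically.conjugator w.toWord with hU
  set C := FreeGroup.reduceCyclically w.toWord with hC
  have hwUC : U ++ C ++ FreeGroup.invRev U = w.toWord :=
    FreeGroup.reduceCyclically.conj_conjugator_reduceCyclically _
  have hpow : ∀ n : ℕ, (w ^ (n + 1)).toWord =
      U ++ (List.replicate (n + 1) C).flatten ++ FreeGroup.invRev U := fun n => by
    rw [FreeGroup.toWord_pow]
    exact FreeGroup.reduceCyclically.reduce_flatten_replicate_succ FreeGroup.isReduced_toWord n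
  rw [← FreeGroup.mk_toWord (x := w), ← hwUC] at hw
  obtain ⟨A, B, x, y, hAB, hx, hxy⟩ := hw.exists_split hT he
  refine ⟨FreeGroup.mk (U ++ A), ⟨U ++ A, y :: B ++ FreeGroup.invRev U, ?_, ?_, rfl⟩,
    fun k l u v => ?_⟩
  · have : U ++ A ++ (y :: B ++ FreeGroup.invRev U) = w.toWord := by simp [← hwUC, hAB]
    exact this ▸ FreeGroup.isReduced_toWord
  · have : U ++ A ++ (y :: B ++ FreeGroup.invRev U) = w.toWord := by simp [← hwUC, hAB]
    rw [this, FreeGroup.mk_toWord]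
  · -- The reduced word of `γ⁻¹ w ^ (k + 1)` begins with `y`.
    have h₁ : G.CoverSide T e (FreeGroup.mk (U ++ A)) (w ^ (k + 1), v) ↔
        G.IsInitialSide T e (G.start (letterEdge y)) := by
      set R := B ++ (List.replicate k C).flatten ++ FreeGroup.invRev U with hR
      have hwk : (w ^ (k + 1)).toWord = (U ++ A) ++ (y :: R) := by
        have hCD (D : List ({e : E // e ∉ T} × Bool)) : C ++ D = A ++ y :: (B ++ D) := by
          rw [hAB, List.append_assoc, List.cons_append]
        rw [hpow, List.replicate_succ, List.flatten_cons, hR, hCD]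
        simp only [List.append_assoc, List.cons_append]
      have hred : FreeGroup.IsReduced (y :: R) := by
        have := FreeGroup.isReduced_toWord (x := w ^ (k + 1))
        rw [hwk] at this
        exact this.infix ⟨U ++ A, [], by simp⟩
      have : ((FreeGroup.mk (U ++ A))⁻¹ * w ^ (k + 1)).toWord = y :: R := by
        rw [← FreeGroup.mk_toWord (x := w ^ (k + 1)), hwk,
          ← FreeGroup.mul_mk (L₁ := U ++ A), inv_mul_cancel_left, FreeGroup.toWord_mk, hred.reduce_eq]
      rw [CoverSide]
      simp only [this]
      rfl
    -- The reduced word of `w ^ (l + 1) γ` ends with `x`.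
    have h₂ : G.CoverSide T e (FreeGroup.mk (U ++ A)) ((w ^ (l + 1))⁻¹, u) ↔
        G.IsInitialSide T e (G.finish (letterEdge x)) := by
      obtain ⟨Z, hZ⟩ := List.getLast?_eq_some_iff.1 hx
      set R := U ++ (List.replicate l C).flatten ++ Z with hR
      have hwl : (w ^ (l + 2)).toWord = (R ++ [x]) ++ (y :: B ++ FreeGroup.invRev U) := by
        have hCC : C ++ C = Z ++ [x] ++ y :: B := by rw [← hZ, List.append_assoc, ← hAB]
        rw [hpow, List.replicate_succ', List.flatten_concat, List.replicate_succ',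
          List.flatten_concat, List.append_assoc _ C C, hCC, hR]
        simp only [List.append_assoc]
      have hred : FreeGroup.IsReduced (R ++ [x]) := by
        have := FreeGroup.isReduced_toWord (x := w ^ (l + 2))
        rw [hwl] at this
        exact this.infix ⟨[], _, rfl⟩
      have hmk : w ^ (l + 1) * FreeGroup.mk (U ++ A) = FreeGroup.mk (R ++ [x]) := by
        rw [← FreeGroup.mk_toWord (x := w ^ (l + 1)), hpow, hR, List.append_assoc _ Z, ← hZ,
          List.replicate_succ', List.flatten_concat]
        simp only [← FreeGroup.mul_mk, ← FreeGroup.inv_mk, mul_assoc, inv_mul_cancel_left]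
      have : ((FreeGroup.mk (U ++ A))⁻¹ * (w ^ (l + 1))⁻¹).toWord =
          (x.1, !x.2) :: FreeGroup.invRev R := by
        rw [← mul_inv_rev, hmk, FreeGroup.toWord_inv, FreeGroup.toWord_mk, hred.reduce_eq]
        simp [FreeGroup.invRev]
      rw [CoverSide]
      simp only [this]
      change G.IsInitialSide T e (G.start ((letterEdge x).1, !(letterEdge x).2)) ↔ _
      rw [start_not]
    rw [h₁, h₂]
    exact hxy

end Axis

/-! ### Rotation elements -/

section Rotation

variable {V E : Type*} {G : DirectedGraph V E} {T : Set E}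

theorem liftPoint_vertex (v : V) :
    G.liftPoint T (G.vertex v) = (G.coverGraph T).vertex (1, v) := rfl

theorem coverGraph_tgt {e : E} (he : e ∈ T) (g : G.Pi1 T) :
    (G.coverGraph T).tgt (g, e) = (g, G.tgt e) :=
  Prod.ext (by simp [coverGraph, theta, he]) rfl

/-- Both endpoints of an edge in the spanning tree have their chosen lifts on the chosen lift of
the edge. -/
theorem liftPoint_point {e : E} (he : e ∈ T) (t : unitInterval) :
    G.liftPoint T (G.point e t) = (G.coverGraph T).point (1, e) t := by
  change (if t = 0 then _ else if t = 1 then _ else _) = _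
  split_ifs with h0 h1
  · rw [h0, point_zero]
    rfl
  · rw [h1, point_one, coverGraph_tgt he]
  · rfl

theorem proj_liftPoint (x : G.Realization) : G.proj T (G.liftPoint T x) = x := by
  classical
  rcases G.eq_vertex_or_eq_point x with ⟨v, rfl⟩ | ⟨d, t, h0, h1, rfl⟩
  · rfl
  · change G.proj T (if t = 0 then _ else if t = 1 then _ else _) = _
    rw [if_neg h0.ne', if_neg h1.ne]
    rfl

variable {f : C(G.Realization, G.Realization)} {F : C(G.UniversalCover T, G.UniversalCover T)}

theorem hasRotationElement_of_iterate_eq (hF : G.IsHomotopyLift T f F) {x : G.Realization} {q : ℕ+}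
    {g : G.Pi1 T} (h : F^[q] (G.liftPoint T x) = G.deck T g (G.liftPoint T x)) :
    G.HasRotationElement T f F x (root g q) := by
  refine ⟨q, ?_, g, h, rfl⟩
  have := congrArg (G.proj T) h
  rwa [hF.proj_iterate, proj_deck, proj_liftPoint] at this

/-- A rotation element `w^{k/m}` is realized by some multiple of `m` as the number of iterations,
and then by all multiples of this multiple. -/
theorem HasRotationElement.exists_iterate_eq (hF : G.IsHomotopyLift T f F) {x : G.Realization}
    {w : G.Pi1 T} {k : ℤ} {m : ℕ+} (h : G.HasRotationElement T f F x (root (w ^ k) m)) :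
    ∃ a : ℕ+, ∀ c : ℕ,
      F^[m * a * c] (G.liftPoint T x) = G.deck T (w ^ (k * a * c)) (G.liftPoint T x) := by
  obtain ⟨n, -, g, hg, hroot⟩ := h
  obtain ⟨a, b, hab, hmn⟩ := Quotient.exact hroot
  refine ⟨a, fun c => ?_⟩
  have hmn' : (m : ℕ) * a = n * b := by exact_mod_cast congrArg PNat.val hmn
  have hab' : (w ^ k) ^ (a : ℕ) = g ^ (b : ℕ) := hab
  rw [hmn', mul_assoc, hF.iterate_mul hg, pow_mul, ← hab', zpow_mul, zpow_mul, zpow_natCast,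
    zpow_natCast]

/-- The intermediate value argument: if `Φ` moves the ends of the lift of `e` by `w ^ a` and `w ^ b`,
with `p` strictly between `a` and `b`, then it moves some point of this lift by `w ^ p γ`. -/
theorem Belongs.exists_apply_point_eq (hT : G.IsSpanningTree T) {e : E} (he : e ∈ T) {x₀ : V}
    {w : G.Pi1 T} (hw : G.Belongs x₀ T e w) {Φ : G.UniversalCover T → G.UniversalCover T}
    (hΦ : Continuous Φ) {a b p : ℤ}
    (ha : Φ ((G.coverGraph T).vertex (1, G.src e)) = (G.coverGraph T).vertex (w ^ a, G.src e))
    (hb : Φ ((G.coverGraph T).vertex (1, G.tgt e)) = (G.coverGraph T).vertex (w ^ b, G.tgt e))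
    (hp : a < p ∧ p < b ∨ b < p ∧ p < a) :
    ∃ γ, IsInitialSubword γ w ∧ ∃ t, Φ ((G.coverGraph T).point (1, e) t) =
      (G.coverGraph T).point (w ^ p * γ, e) t := by
  obtain ⟨γ, hγ, hsep⟩ := hw.exists_coverSide hT he
  have htrans (c : ℤ) (u : V) :
      G.CoverSide T e (w ^ p * γ) (w ^ c, u) ↔ G.CoverSide T e γ (w ^ (c - p), u) := by
    simp only [CoverSide]
    rw [mul_inv_rev, mul_assoc, ← zpow_neg, ← zpow_add, neg_add_eq_sub]
  have hlt {c d : ℤ} (hc : c < p) (hd : p < d) (u v : V) :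
      ¬ (G.CoverSide T e (w ^ p * γ) (w ^ c, u) ↔ G.CoverSide T e (w ^ p * γ) (w ^ d, v)) := by
    obtain ⟨l, hl⟩ := Int.eq_ofNat_of_zero_le (show 0 ≤ p - c - 1 by omega)
    obtain ⟨k, hk⟩ := Int.eq_ofNat_of_zero_le (show 0 ≤ d - p - 1 by omega)
    have hl' : w ^ (c - p) = (w ^ (l + 1))⁻¹ := by
      rw [show c - p = -((l + 1 : ℕ) : ℤ) by push_cast; omega, zpow_neg, zpow_natCast]
    have hk' : w ^ (d - p) = w ^ (k + 1) := by
      rw [show d - p = ((k + 1 : ℕ) : ℤ) by push_cast; omega, zpow_natCast]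
    rw [htrans, htrans, hl', hk']
    exact hsep k l u v
  refine ⟨γ, hγ, (G.coverGraph T).exists_eq_point_of_separated (e := (w ^ p * γ, e))
    (S := G.CoverSide T e (w ^ p * γ)) (coverSide_src _) ?_
    (fun d hd => coverSide_src_iff_tgt _ hd)
    (hΦ.comp ((G.coverGraph T).continuous_point (1, e)))
    (a := (w ^ a, G.src e)) (b := (w ^ b, G.tgt e)) ?_ ?_ ?_⟩
  · rw [coverGraph_tgt he]
    exact not_coverSide_tgt hT he _
  · exact (congrArg Φ (point_zero _ _)).trans ha
  · exact (congrArg Φ (point_one _ _)).trans (by rw [coverGraph_tgt he, hb])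
  · rcases hp with ⟨h₁, h₂⟩ | ⟨h₁, h₂⟩
    · exact hlt h₁ h₂ _ _
    · exact fun h => hlt h₁ h₂ _ _ h.symm

theorem isInitialSubword_one {α : Type*} (w : FreeGroup α) : IsInitialSubword 1 w := by
  classical
  exact ⟨[], w.toWord, by simpa using FreeGroup.isReduced_toWord, by simp [FreeGroup.mk_toWord], rfl⟩

end Rotation

end DirectedGraph

theorem mainTheorem2 {V E : Type*} [Finite V] [Finite E] (G : DirectedGraph V E)
    (x₀ : V) (T : Set E) (hT : G.IsSpanningTree T)
    (f : C(G.Realization, G.Realization)) (hf : G.IsVertexMap f)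
    (F : C(G.UniversalCover T, G.UniversalCover T)) (hF : G.IsHomotopyLift T f F)
    (e : E) (he : e ∈ T) (w : G.Pi1 T) (hw : G.Belongs x₀ T e w)
    (k₁ k₂ : ℤ) (m n : ℕ+)
    (h₁ : G.HasRotationElement T f F (G.vertex (G.src e)) (DirectedGraph.root (w ^ k₁) m))
    (h₂ : G.HasRotationElement T f F (G.vertex (G.tgt e)) (DirectedGraph.root (w ^ k₂) n))
    (r : ℚ) (hr : r ∈ Set.uIcc ((k₁ : ℚ) / (m : ℕ)) ((k₂ : ℚ) / (n : ℕ))) :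
    ∃ (p : ℤ) (q : ℕ+), (p : ℚ) / (q : ℕ) = r ∧
      ∃ x ∈ G.edge e, ∃ γ : G.Pi1 T, DirectedGraph.IsInitialSubword γ w ∧
        G.HasRotationElement T f F x (DirectedGraph.root (w ^ p * γ) q) := by
  obtain ⟨a, ha⟩ := h₁.exists_iterate_eq hF
  obtain ⟨b, hb⟩ := h₂.exists_iterate_eq hF
  let d : ℕ+ := ⟨r.den, r.den_pos⟩
  -- A common number of iterations, divisible by the denominator of `r`.
  let q : ℕ+ := m * a * (n * b * d)
  let A : ℤ := k₁ * a * (n * b * d : ℕ)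
  let B : ℤ := k₂ * b * (m * a * d : ℕ)
  let p : ℤ := r.num * (m * a * (n * b) : ℕ)
  have hqN : (q : ℕ) = m * a * (n * b * r.den) := rfl
  have hq : ((q : ℕ) : ℚ) = m * a * (n * b * r.den) := by
    rw [hqN]
    push_cast
    rfl
  have hA : F^[q] (G.liftPoint T (G.vertex (G.src e))) =
      G.deck T (w ^ A) (G.liftPoint T (G.vertex (G.src e))) := ha _
  have hB : F^[q] (G.liftPoint T (G.vertex (G.tgt e))) =
      G.deck T (w ^ B) (G.liftPoint T (G.vertex (G.tgt e))) := by
    rw [← hb, show (q : ℕ) = n * b * (m * a * d) by simp only [q, PNat.mul_coe]; ring]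
  have hm : (m : ℚ) ≠ 0 := by exact_mod_cast m.ne_zero
  have hn : (n : ℚ) ≠ 0 := by exact_mod_cast n.ne_zero
  have hq0 : (0 : ℚ) < (q : ℕ) := by exact_mod_cast q.pos
  have hpq : (p : ℚ) = r * (q : ℕ) := by
    rw [hq]
    simp only [p]
    push_cast
    rw [← Rat.mul_den_eq_num r]
    ring
  have hAq : (A : ℚ) = k₁ / (m : ℕ) * (q : ℕ) := by
    rw [hq]
    simp only [A, d, PNat.mk_coe]
    push_cast
    field_simp
  have hBq : (B : ℚ) = k₂ / (n : ℕ) * (q : ℕ) := by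
    rw [hq]
    simp only [B, d, PNat.mk_coe]
    push_cast
    field_simp
  have hpAB : A ≤ p ∧ p ≤ B ∨ B ≤ p ∧ p ≤ A := by
    rw [Set.mem_uIcc] at hr
    simp only [← Int.cast_le (R := ℚ), hpq, hAq, hBq]
    exact hr.imp (fun h => ⟨by gcongr; exact h.1, by gcongr; exact h.2⟩)
      fun h => ⟨by gcongr; exact h.1, by gcongr; exact h.2⟩
  refine ⟨p, q, by rw [hpq, mul_div_cancel_right₀ _ hq0.ne'], ?_⟩
  rcases eq_or_ne p A with hpA | hpA
  · refine ⟨_, ⟨0, G.point_zero e⟩, 1, DirectedGraph.isInitialSubword_one w, ?_⟩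
    exact DirectedGraph.hasRotationElement_of_iterate_eq hF (by rw [mul_one, hpA, hA])
  rcases eq_or_ne p B with hpB | hpB
  · refine ⟨_, ⟨1, G.point_one e⟩, 1, DirectedGraph.isInitialSubword_one w, ?_⟩
    exact DirectedGraph.hasRotationElement_of_iterate_eq hF (by rw [mul_one, hpB, hB])
  obtain ⟨γ, hγ, t, ht⟩ := hw.exists_apply_point_eq hT he (F.continuous.iterate q)
    (a := A) (b := B) (p := p)
    (by simpa only [DirectedGraph.liftPoint_vertex, DirectedGraph.deck_vertex, mul_one] using hA)
    (by simpa only [DirectedGraph.liftPoint_vertex, DirectedGraph.deck_vertex, mul_one] using hB)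
    (by omega)
  refine ⟨_, ⟨t, rfl⟩, γ, hγ, DirectedGraph.hasRotationElement_of_iterate_eq hF ?_⟩
  rw [DirectedGraph.liftPoint_point he, ht, DirectedGraph.deck_point, mul_one]
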